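/- Let $n\in\mathbb{N}$, let $\mathbb{T}^n=\mathbb{R}^n/\mathbb{Z}^n$ carry its normalised Haar measure, and let $1\le p<\infty$. Let $(Y,\nu)$ be a $\sigma$-finite measure space such that the complex Hilbert space $H=L^2(Y,\nu)$ is separable, and let $\sigma:\mathbb{T}^n\times\mathbb{Z}^n\to\mathcal{L}(H)$ be a function with values in the bounded linear operators on $H$. Let $T_\sigma:L^p(\mathbb{T}^n,H)\to L^p(\mathbb{T}^n,H)$ be a linear operator that is the periodic pseudo-differential operator with symbol $\sigma$, i.e. for every $f\in C^\infty(\mathbb{T}^n,H)$ and almost every $x\in\mathbb{T}^n$, $$T_\sigma f(x)=\sum_{\xi\in\mathbb{Z}^n}e^{2\pi i x\cdot\xi}\,\sigma(x,\xi)\widehat f(\xi),\qquad \widehat f(\xi)=\int_{\mathbb{T}^n}e^{-2\pi i x\cdot\xi}f(x)\,dx,$$ where the series converges unconditionally in $H$. A linear operator $T:E\to F$ between Banach spaces is called nuclear if there are sequences $(g_k)\subset E'$ and $(h_k)\subset F$ with $\sum_k\|g_k\|_{E'}\|h_k\|_F<\infty$ and $Tf=\sum_k\langle g_k,f\rangle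 h_k$ for all $f\in E$. If $T_\sigma$ is nuclear on $L^p(\mathbb{T}^n,H)$, then for almost every $(x,\xi)\in\mathbb{T}^n\times\mathbb{Z}^n$ (with respect to the product of the Haar measure and the counting measure) the operator $\sigma(x,\xi)$ is nuclear and trace class on $H$, the latter meaning that $\sum_i\langle|\sigma(x,\xi)|e_i,e_i\rangle<\infty$ for every orthonormal basis $(e_i)$ of $H$, where $|A|=(A^*A)^{1/2}$. -/

import Mathlib

open MeasureTheory UnitAddTorus
open scoped ENNReal InnerProductSpace

/-- A linear operator `T : E → F` between normed spaces is nuclear if there are sequences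
`g k` in the dual of `E` and `h k` in `F` with `∑ ‖g k‖ * ‖h k‖ < ∞` and
`T f = ∑ ⟨g k, f⟩ h k` for every `f`. -/
def IsNuclear {𝕜 E F : Type*} [RCLike 𝕜] [NormedAddCommGroup E] [NormedSpace 𝕜 E]
    [NormedAddCommGroup F] [NormedSpace 𝕜 F] (T : E →ₗ[𝕜] F) : Prop :=
  ∃ (g : ℕ → StrongDual 𝕜 E) (h : ℕ → F),
    Summable (fun k => ‖g k‖ * ‖h k‖) ∧ ∀ f : E, HasSum (fun k => g k f • h k) (T f)

/-- A bounded operator `A` on a complex Hilbert space is trace class if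
`∑ᵢ ⟨|A| eᵢ, eᵢ⟩ < ∞` for the orthonormal bases `(eᵢ)` of the space, where `|A| = (A* A)^{1/2}`. -/
def IsTraceClassOp {H : Type*} [NormedAddCommGroup H] [InnerProductSpace ℂ H] [CompleteSpace H]
    (A : H →L[ℂ] H) : Prop :=
  ∀ (s : Set H) (b : HilbertBasis s ℂ H), Summable (fun i => ⟪b i, CFC.abs A (b i)⟫_ℂ)

/-- A continuous function on the torus `(ℝ / ℤ) ^ n` is smooth if its periodic lift to `ℝ ^ n`
is smooth. -/
def TorusSmooth {n : ℕ} {H : Type*} [NormedAddCommGroup H] [NormedSpace ℂ H]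
    (f : C(UnitAddTorus (Fin n), H)) : Prop :=
  letI : NormedSpace ℝ H := NormedSpace.restrictScalars ℝ ℂ H
  ContDiff ℝ (⊤ : ℕ∞) (fun y : Fin n → ℝ => f (fun i => (y i : UnitAddCircle)))

/-- The linear operator `T` on `L^p(𝕋ⁿ, H)` is the vector-valued periodic pseudo-differential
operator `T_σ` with operator-valued symbol `σ : 𝕋ⁿ × ℤⁿ → 𝓛(H)`: for every smooth `f : 𝕋ⁿ → H`,
`T f (x) = ∑_{ξ ∈ ℤⁿ} e^{2πi x·ξ} σ(x, ξ) f̂(ξ)` for almost every `x`, where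
`f̂(ξ) = ∫ e^{-2πi x·ξ} f(x) dx`. -/
def IsPeriodicPseudoDiffOp {n : ℕ} {H : Type*} [NormedAddCommGroup H] [NormedSpace ℂ H]
    {p : ℝ≥0∞} [Fact (1 ≤ p)] (σ : UnitAddTorus (Fin n) × (Fin n → ℤ) → (H →L[ℂ] H))
    (T : Lp H p (volume : Measure (UnitAddTorus (Fin n))) →ₗ[ℂ]
      Lp H p (volume : Measure (UnitAddTorus (Fin n)))) : Prop :=
  ∀ f : C(UnitAddTorus (Fin n), H), TorusSmooth f →
    ∀ᵐ x : UnitAddTorus (Fin n),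
      HasSum (fun ξ : Fin n → ℤ => mFourier ξ x • σ (x, ξ) (mFourierCoeff f ξ))
        (T (ContinuousMap.toLp (E := H) p volume ℂ f) x)

/-! Test `T` on `e^{2πi x·ξ} v`: orthogonality of characters leaves one term, so `T` returns `e^{2πi
x·ξ} σ(x, ξ) v`. Precomposing the functionals of a nuclear representation of `T` with `v ↦ e^{2πi
x·ξ} v` gives functionals on `H`. Since `L^p` embeds in `L^1` on the torus, the vectors `h k x` have
a summable weighted norm series for almost every `x`, so evaluating the representation at `x` gives
one for `σ(x, ξ)`, up to a unimodular factor.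

Nuclear implies trace class because `|A| = C A` for a bounded `C`, so `|A|` is again nuclear, and
Bessel's inequality bounds its diagonal sums. -/

/-- The absolute value of a bounded operator `A` on a Hilbert space preserves the norms of `A`. -/
theorem norm_cfcAbs_apply {H : Type*} [NormedAddCommGroup H] [InnerProductSpace ℂ H]
    [CompleteSpace H] (A : H →L[ℂ] H) (v : H) : ‖CFC.abs A v‖ = ‖A v‖ := by
  have hsa : IsSelfAdjoint (CFC.abs A) := (CFC.abs_nonneg A).isSelfAdjoint
  have h : ⟪CFC.abs A v, CFC.abs A v⟫_ℂ = ⟪A v, A v⟫_ℂ := by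
    rw [← ContinuousLinearMap.adjoint_inner_right, ← ContinuousLinearMap.adjoint_inner_right,
      hsa.adjoint_eq]
    change ⟪v, (CFC.abs A * CFC.abs A) v⟫_ℂ = _
    rw [CFC.abs_mul_abs]
    rfl
  rw [inner_self_eq_norm_sq_to_K, inner_self_eq_norm_sq_to_K] at h
  have h2 : ‖CFC.abs A v‖ ^ 2 = ‖A v‖ ^ 2 := by exact_mod_cast h
  exact (sq_eq_sq₀ (norm_nonneg _) (norm_nonneg _)).1 h2

/-- The absolute value of `A` factors through `A` on the left. -/
theorem exists_comp_eq_cfcAbs {H : Type*} [NormedAddCommGroup H] [InnerProductSpace ℂ H]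
    [CompleteSpace H] (A : H →L[ℂ] H) : ∃ C : H →L[ℂ] H, ∀ v, C (A v) = CFC.abs A v := by
  let K : Submodule ℂ H := (LinearMap.range (A : H →ₗ[ℂ] H)).topologicalClosure
  have hK : ∀ v, A v ∈ K := fun v =>
    Submodule.le_topologicalClosure _ (LinearMap.mem_range_self (A : H →ₗ[ℂ] H) v)
  have : CompleteSpace K :=
    (Submodule.isClosed_topologicalClosure _).completeSpace_coe
  let e : H →ₗ[ℂ] K := (A : H →ₗ[ℂ] H).codRestrict K hK
  have he : DenseRange e := by
    intro y
    rw [closure_subtype]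
    have hy : (y : H) ∈ closure (Set.range A) := y.2
    have hr : (Subtype.val '' Set.range e) = Set.range A := by
      rw [← Set.range_comp]
      rfl
    rw [hr]
    exact hy
  -- Equality of norms makes `A v ↦ |A| v` well defined and bounded on the range of `A`, so it
  -- extends to the closure `K`; the projection then makes it zero on the complement of `K`.
  have hb : ∀ v, ‖((CFC.abs A : H →L[ℂ] H) : H →ₗ[ℂ] H) v‖ ≤ 1 * ‖e v‖ := fun v => by
    rw [one_mul]
    exact (norm_cfcAbs_apply A v).le
  refine ⟨(((CFC.abs A : H →L[ℂ] H) : H →ₗ[ℂ] H).extendOfNorm e).comp K.orthogonalProjectionOnto, fun v => ?_⟩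
  have hp : K.orthogonalProjectionOnto (A v) = e v :=
    Submodule.orthogonalProjectionOnto_mem_subspace_eq_self (K := K) (⟨A v, hK v⟩ : K)
  rw [ContinuousLinearMap.comp_apply, hp, LinearMap.extendOfNorm_eq he ⟨1, hb⟩]
  rfl

/-- Bessel's inequality in polarised form. -/
theorem Orthonormal.sum_norm_inner_mul_norm_inner_le {𝕜 E ι : Type*} [RCLike 𝕜]
    [NormedAddCommGroup E] [InnerProductSpace 𝕜 E] {b : ι → E} (hb : Orthonormal 𝕜 b)
    (y z : E) (F : Finset ι) :
    ∑ i ∈ F, ‖inner 𝕜 (b i) y‖ * ‖inner 𝕜 (b i) z‖ ≤ ‖y‖ * ‖z‖ := by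
  refine (Real.sum_mul_le_sqrt_mul_sqrt F _ _).trans ?_
  have h : ∀ x : E, √(∑ i ∈ F, ‖inner 𝕜 (b i) x‖ ^ 2) ≤ ‖x‖ := fun x =>
    Real.sqrt_le_iff.2 ⟨norm_nonneg x, hb.sum_inner_products_le x⟩
  gcongr <;> exact h _

/-- A nuclear operator on a Hilbert space has absolutely summable diagonal in every orthonormal
family. -/
theorem IsNuclear.summable_norm_inner {𝕜 H ι : Type*} [RCLike 𝕜] [NormedAddCommGroup H]
    [InnerProductSpace 𝕜 H] [CompleteSpace H] {B : H →ₗ[𝕜] H} (hB : IsNuclear B)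
    {b : ι → H} (hb : Orthonormal 𝕜 b) : Summable (fun i => ‖inner 𝕜 (b i) (B (b i))‖) := by
  obtain ⟨g, h, hs, hsum⟩ := hB
  have hg : ∀ k v, ‖g k v‖ = ‖inner 𝕜 v ((InnerProductSpace.toDual 𝕜 H).symm (g k))‖ := by
    intro k v
    rw [norm_inner_symm, InnerProductSpace.toDual_symm_apply]
  have hle : ∀ v k, ‖inner 𝕜 v (g k v • h k)‖ ≤ ‖g k v‖ * ‖inner 𝕜 v (h k)‖ := fun v k => by
    rw [inner_smul_right, norm_mul]
  have hsv : ∀ i, Summable (fun k => ‖g k (b i)‖ * ‖inner 𝕜 (b i) (h k)‖) := by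
    intro i
    refine hs.of_nonneg_of_le (fun k => by positivity) fun k => ?_
    have h1 := (g k).le_opNorm (b i)
    have h2 := norm_inner_le_norm (𝕜 := 𝕜) (b i) (h k)
    rw [hb.1 i, mul_one] at h1
    rw [hb.1 i, one_mul] at h2
    gcongr
  refine summable_of_sum_le (c := ∑' k, ‖g k‖ * ‖h k‖) (fun i => norm_nonneg _) fun F => ?_
  calc ∑ i ∈ F, ‖inner 𝕜 (b i) (B (b i))‖
      ≤ ∑ i ∈ F, ∑' k, ‖g k (b i)‖ * ‖inner 𝕜 (b i) (h k)‖ := by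
        refine Finset.sum_le_sum fun i _ => ?_
        have h1 : HasSum (fun k => inner 𝕜 (b i) (g k (b i) • h k)) (inner 𝕜 (b i) (B (b i))) :=
          (hsum (b i)).mapL (innerSL 𝕜 (b i))
        rw [← h1.tsum_eq]
        exact tsum_of_norm_bounded (hsv i).hasSum (hle (b i))
    _ = ∑' k, ∑ i ∈ F, ‖g k (b i)‖ * ‖inner 𝕜 (b i) (h k)‖ :=
        (Summable.tsum_finsetSum fun i _ => hsv i).symm
    _ ≤ ∑' k, ‖g k‖ * ‖h k‖ := by
        refine Summable.tsum_le_tsum (fun k => ?_) (summable_sum fun i _ => hsv i) hs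
        -- With `g k` replaced by its Riesz vector, Bessel bounds the sum over `F` by `‖g k‖ * ‖h
        -- k‖`, independently of `F`.
        simp_rw [hg]
        refine (hb.sum_norm_inner_mul_norm_inner_le _ _ F).trans_eq ?_
        rw [LinearIsometryEquiv.norm_map]

theorem IsNuclear.continuousLinearMap_comp {𝕜 E F G : Type*} [RCLike 𝕜] [NormedAddCommGroup E]
    [NormedSpace 𝕜 E] [NormedAddCommGroup F] [NormedSpace 𝕜 F] [NormedAddCommGroup G]
    [NormedSpace 𝕜 G] {A : E →ₗ[𝕜] F} (hA : IsNuclear A) (C : F →L[𝕜] G) :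
    IsNuclear ((C : F →ₗ[𝕜] G) ∘ₗ A) := by
  obtain ⟨g, h, hs, hsum⟩ := hA
  refine ⟨g, fun k => C (h k), ?_, fun f => ?_⟩
  · refine (hs.mul_left ‖C‖).of_nonneg_of_le (fun k => by positivity) fun k => ?_
    rw [mul_left_comm]
    gcongr
    exact C.le_opNorm _
  · simpa using (hsum f).mapL C

/-- A nuclear operator on a Hilbert space is trace class. -/
theorem IsNuclear.isTraceClassOp {H : Type*} [NormedAddCommGroup H] [InnerProductSpace ℂ H]
    [CompleteSpace H] {A : H →L[ℂ] H} (hA : IsNuclear (A : H →ₗ[ℂ] H)) : IsTraceClassOp A := by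
  intro s b
  obtain ⟨C, hC⟩ := exists_comp_eq_cfcAbs A
  refine Summable.of_norm ?_
  simpa [hC] using (hA.continuousLinearMap_comp C).summable_norm_inner b.orthonormal

/-- An absolutely convergent series in `L^p` over a finite measure converges absolutely
almost everywhere. -/
theorem ae_summable_mul_norm_of_summable_norm {α E : Type*} [MeasurableSpace α] {μ : Measure α}
    [IsFiniteMeasure μ] [NormedAddCommGroup E] {p : ℝ≥0∞} [Fact (1 ≤ p)]
    {c : ℕ → ℝ} (hc : ∀ k, 0 ≤ c k) {h : ℕ → Lp E p μ} (hs : Summable fun k => c k * ‖h k‖) :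
    ∀ᵐ x ∂μ, Summable fun k => c k * ‖h k x‖ := by
  have hp : (1 : ℝ≥0∞) ≤ p := Fact.out
  -- Hölder against the constant 1: `M = μ(univ)^(1 - 1/p)`, finite because the exponent is
  -- nonnegative.
  obtain ⟨M, hM, hMh⟩ : ∃ M : ℝ≥0∞, M ≠ ⊤ ∧ ∀ f : Lp E p μ, ∫⁻ x, ‖f x‖ₑ ∂μ ≤ ‖f‖ₑ * M := by
    refine ⟨μ Set.univ ^ (1 / (1 : ℝ≥0∞).toReal - 1 / p.toReal), ?_, fun f => ?_⟩
    · refine ENNReal.rpow_ne_top_of_nonneg ?_ (measure_ne_top μ _)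
      rcases eq_or_ne p ⊤ with rfl | h
      · simp
      · have : 1 ≤ p.toReal := by simpa using ENNReal.toReal_mono h hp
        simpa using inv_le_one_of_one_le₀ this
    · rw [← eLpNorm_one_eq_lintegral_enorm, Lp.enorm_def]
      exact eLpNorm_le_eLpNorm_mul_rpow_measure_univ hp (Lp.aestronglyMeasurable f)
  have hmeas : ∀ k, AEMeasurable (fun x => ENNReal.ofReal (c k) * ‖h k x‖ₑ) μ := fun k =>
    (Lp.aestronglyMeasurable (h k)).enorm.const_mul _
  have hfin : ∫⁻ x, ∑' k, ENNReal.ofReal (c k) * ‖h k x‖ₑ ∂μ ≠ ⊤ := by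
    rw [lintegral_tsum hmeas]
    refine ne_top_of_le_ne_top (b := (∑' k, ENNReal.ofReal (c k * ‖h k‖)) * M)
      (ENNReal.mul_ne_top hs.tsum_ofReal_ne_top hM) ?_
    rw [← ENNReal.tsum_mul_right]
    refine ENNReal.tsum_le_tsum fun k => ?_
    rw [lintegral_const_mul' _ _ ENNReal.ofReal_ne_top, ENNReal.ofReal_mul (hc k), mul_assoc,
      ofReal_norm]
    gcongr
    exact hMh _
  filter_upwards [ae_lt_top' (AEMeasurable.tsum hmeas) hfin] with x hx
  refine (ENNReal.summable_toReal hx.ne).congr fun k => ?_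
  simp [ENNReal.toReal_mul, hc k]

/-- If a series converges in `L^p`, and converges pointwise almost everywhere, the two sums
agree. -/
theorem MeasureTheory.Lp.ae_eq_of_hasSum {α E : Type*} [MeasurableSpace α] {μ : Measure α}
    [NormedAddCommGroup E] {p : ℝ≥0∞} [Fact (1 ≤ p)] {u : ℕ → Lp E p μ} {S : Lp E p μ}
    {s : α → E} (hS : HasSum u S) (hs : ∀ᵐ x ∂μ, HasSum (fun k => u k x) (s x)) :
    S =ᵐ[μ] s := by
  have hp : p ≠ 0 := (zero_lt_one.trans_le (Fact.out : (1 : ℝ≥0∞) ≤ p)).ne'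
  -- A subsequence of partial sums suffices, since the whole series already converges pointwise.
  obtain ⟨φ, hφ, hlim⟩ :=
    (tendstoInMeasure_of_tendsto_Lp hS.tendsto_sum_nat).exists_seq_tendsto_ae
  have hcoe : ∀ᵐ x ∂μ, ∀ N, (∑ k ∈ Finset.range N, u k : Lp E p μ) x
      = ∑ k ∈ Finset.range N, u k x := by
    rw [ae_all_iff]
    intro N
    exact Lp.coeFn_fun_finsetSum (Finset.range N) u
  filter_upwards [hlim, hcoe, hs] with x h1 h2 h3
  refine tendsto_nhds_unique h1 ?_
  simp_rw [h2]
  exact h3.tendsto_sum_nat.comp hφ.tendsto_atTop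

/-- The function `x ↦ e^{2πi x·ξ} v` on the torus, as a continuous linear function of the
vector `v`. -/
noncomputable def mFourierSMul {n : ℕ} {H : Type*} [NormedAddCommGroup H] [NormedSpace ℂ H]
    (ξ : Fin n → ℤ) : H →L[ℂ] C(UnitAddTorus (Fin n), H) :=
  LinearMap.mkContinuous
    { toFun := fun v => ⟨fun x => mFourier ξ x • v, by fun_prop⟩
      map_add' := fun v w => by ext x; simp
      map_smul' := fun c v => by ext x; simp [smul_comm c] } 1 fun v => by
    rw [ContinuousMap.norm_le _ (by positivity)]
    intro x
    change ‖mFourier ξ x • v‖ ≤ _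
    rw [norm_smul]
    gcongr
    exact ((mFourier ξ).norm_coe_le_norm x).trans_eq mFourier_norm

theorem mFourierSMul_apply {n : ℕ} {H : Type*} [NormedAddCommGroup H] [NormedSpace ℂ H]
    (ξ : Fin n → ℤ) (v : H) (x : UnitAddTorus (Fin n)) :
    mFourierSMul ξ v x = mFourier ξ x • v := rfl

theorem torusSmooth_mFourierSMul {n : ℕ} {H : Type*} [NormedAddCommGroup H] [NormedSpace ℂ H]
    (ξ : Fin n → ℤ) (v : H) : TorusSmooth (mFourierSMul ξ v) := by
  let : NormedSpace ℝ H := NormedSpace.restrictScalars ℝ ℂ H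
  have : IsScalarTower ℝ ℂ H := ⟨fun a b x => by
    rw [Complex.real_smul, mul_smul]
    rfl⟩
  change ContDiff ℝ (⊤ : ℕ∞)
    (fun y : Fin n → ℝ => (∏ i, fourier (ξ i) ((y i : UnitAddCircle))) • v)
  have h : ContDiff ℝ (⊤ : ℕ∞)
      (fun y : Fin n → ℝ => ∏ i, (fourier (ξ i) ((y i : UnitAddCircle)) : ℂ)) := by
    refine contDiff_prod fun i _ => ?_
    simp_rw [fourier_coe_apply]
    have h1 : ContDiff ℝ (⊤ : ℕ∞) (fun y : Fin n → ℝ => ((y i : ℝ) : ℂ)) :=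
      Complex.ofRealCLM.contDiff.comp (contDiff_apply ℝ ℝ i)
    exact ((contDiff_const.mul h1).div_const _).cexp
  exact h.smul contDiff_const

theorem mFourierCoeff_mFourierSMul {n : ℕ} {H : Type*} [NormedAddCommGroup H] [NormedSpace ℂ H]
    [CompleteSpace H] (ξ η : Fin n → ℤ) (v : H) :
    mFourierCoeff (mFourierSMul ξ v) η = if η = ξ then v else 0 := by
  have h1 : mFourierCoeff (mFourierSMul ξ v) η = mFourierCoeff (mFourier ξ) η • v := by
    unfold mFourierCoeff
    rw [← integral_smul_const]
    simp only [mFourierSMul_apply, smul_smul, smul_eq_mul]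
  have h2 : mFourierCoeff (mFourier ξ) η = if η = ξ then 1 else 0 := by
    classical
    -- Read the coefficient in the Fourier basis of `L^2`, where a character is a basis vector.
    rw [← mFourierCoeff_toLp, ← mFourierBasis_repr]
    change mFourierBasis.repr (mFourierLp 2 ξ) η = _
    rw [← coe_mFourierBasis, HilbertBasis.repr_self, lp.single_apply]
    simp [Pi.single_apply]
  rw [h1, h2]
  split_ifs <;> simp

/-- A periodic pseudo-differential operator acts on `e^{2πi x·ξ} v` through its symbol at `ξ`. -/
theorem IsPeriodicPseudoDiffOp.ae_apply_mFourierSMul {n : ℕ} {H : Type*} [NormedAddCommGroup H]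
    [NormedSpace ℂ H] [CompleteSpace H] {p : ℝ≥0∞} [Fact (1 ≤ p)]
    {σ : UnitAddTorus (Fin n) × (Fin n → ℤ) → (H →L[ℂ] H)}
    {T : Lp H p (volume : Measure (UnitAddTorus (Fin n))) →ₗ[ℂ]
      Lp H p (volume : Measure (UnitAddTorus (Fin n)))}
    (hσ : IsPeriodicPseudoDiffOp σ T) (ξ : Fin n → ℤ) (v : H) :
    ∀ᵐ x : UnitAddTorus (Fin n),
      T (ContinuousMap.toLp (E := H) p volume ℂ (mFourierSMul ξ v)) x
        = mFourier ξ x • σ (x, ξ) v := by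
  filter_upwards [hσ _ (torusSmooth_mFourierSMul ξ v)] with x hx
  refine hx.unique ?_
  have h := hasSum_single (f := fun η : Fin n → ℤ =>
    mFourier η x • σ (x, η) (mFourierCoeff (mFourierSMul ξ v) η)) ξ fun η hη => by
      simp [mFourierCoeff_mFourierSMul, hη]
  simpa [mFourierCoeff_mFourierSMul] using h

/-- Almost every value of the symbol of a nuclear periodic pseudo-differential operator is
nuclear. -/
theorem IsPeriodicPseudoDiffOp.ae_isNuclear {n : ℕ} {H : Type*} [NormedAddCommGroup H]
    [NormedSpace ℂ H] [CompleteSpace H] [TopologicalSpace.SeparableSpace H] {p : ℝ≥0∞}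
    [Fact (1 ≤ p)] {σ : UnitAddTorus (Fin n) × (Fin n → ℤ) → (H →L[ℂ] H)}
    {T : Lp H p (volume : Measure (UnitAddTorus (Fin n))) →ₗ[ℂ]
      Lp H p (volume : Measure (UnitAddTorus (Fin n)))}
    (hσ : IsPeriodicPseudoDiffOp σ T) (hT : IsNuclear T) (ξ : Fin n → ℤ) :
    ∀ᵐ x : UnitAddTorus (Fin n), IsNuclear (σ (x, ξ) : H →ₗ[ℂ] H) := by
  obtain ⟨g, h, hs, hsum⟩ := hT
  let L : H →L[ℂ] Lp H p (volume : Measure (UnitAddTorus (Fin n))) :=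
    (ContinuousMap.toLp (E := H) p volume ℂ).comp (mFourierSMul ξ)
  let G : ℕ → StrongDual ℂ H := fun k => (g k).comp L
  have hG : Summable fun k => ‖G k‖ * ‖h k‖ := by
    refine (hs.mul_right ‖L‖).of_nonneg_of_le (fun k => by positivity) fun k => ?_
    rw [mul_right_comm]
    gcongr
    exact (g k).opNorm_comp_le L
  -- Weighting by `‖G k‖` rather than `|G k v|` gives one null set valid for all `v`.
  have hx := ae_summable_mul_norm_of_summable_norm (fun k => norm_nonneg (G k)) hG
  have hconv : ∀ (F : ℕ → H), (Summable fun k => ‖G k‖ * ‖F k‖) → ∀ v,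
      Summable fun k => G k v • F k := by
    intro F hF v
    refine Summable.of_norm_bounded (hF.mul_right ‖v‖) fun k => ?_
    rw [norm_smul, mul_right_comm]
    gcongr
    exact (G k).le_opNorm v
  have hTv : ∀ v, ∀ᵐ x : UnitAddTorus (Fin n),
      mFourier ξ x • σ (x, ξ) v = ∑' k, G k v • h k x := by
    intro v
    have hcoe : ∀ᵐ x : UnitAddTorus (Fin n), ∀ k, (G k v • h k) x = G k v • h k x := by
      rw [ae_all_iff]
      intro k
      exact Lp.coeFn_smul _ _
    have hae := MeasureTheory.Lp.ae_eq_of_hasSum (s := fun x => ∑' k, G k v • h k x) (hsum (L v)) (by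
      filter_upwards [hx, hcoe] with x hx hcoe
      refine (hconv _ hx v).hasSum.congr_fun ?_
      exact hcoe)
    filter_upwards [hσ.ae_apply_mFourierSMul ξ v, hae] with x h1 h2
    rw [← h1, ← h2]
    rfl
  -- The null set in `hTv` depends on `v`; separability reduces to countably many `v`, and
  -- continuity recovers the rest.
  have hdense := (ae_all_iff (ι := ℕ)).2 fun i => hTv (TopologicalSpace.denseSeq H i)
  filter_upwards [hx, hdense] with x hx hd
  have hunit : mFourier (-ξ) x * mFourier ξ x = 1 := by
    rw [← mFourier_add, neg_add_cancel, mFourier_zero, ContinuousMap.one_apply]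
  let B : H →L[ℂ] H := ∑' k, (G k).smulRight (h k x)
  have hBs : Summable fun k => (G k).smulRight (h k x) :=
    Summable.of_norm (by simpa [ContinuousLinearMap.norm_smulRight_apply] using hx)
  have hB : ∀ v, HasSum (fun k => G k v • h k x) (B v) := fun v =>
    hBs.hasSum.mapL (ContinuousLinearMap.apply ℂ H v)
  have hBσ : mFourier ξ x • σ (x, ξ) = B := by
    refine ContinuousLinearMap.coeFn_injective ?_
    refine (TopologicalSpace.denseRange_denseSeq H).equalizer (ContinuousLinearMap.continuous _)
      B.continuous (funext fun i => ?_)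
    exact (hd i).trans (hB _).tsum_eq
  refine ⟨G, fun k => mFourier (-ξ) x • h k x, ?_, fun v => ?_⟩
  · refine hx.of_nonneg_of_le (fun k => by positivity) fun k => ?_
    rw [norm_smul]
    have : ‖mFourier (-ξ) x‖ ≤ 1 := ((mFourier (-ξ)).norm_coe_le_norm x).trans_eq mFourier_norm
    gcongr
    exact mul_le_of_le_one_left (norm_nonneg _) this
  · have h1 := (hB v).const_smul (mFourier (-ξ) x)
    rw [← hBσ, smul_apply, smul_smul, hunit, one_smul] at h1
    simpa only [smul_comm (mFourier (-ξ) x), ContinuousLinearMap.coe_coe] using h1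

/-- A property holds almost everywhere for a product with the counting measure on a countable
space if it holds almost everywhere on every slice. -/
theorem ae_prod_count_of_forall_ae {α β : Type*} [MeasurableSpace α] [MeasurableSpace β]
    [Countable β] [MeasurableSingletonClass β] {μ : Measure α} [SFinite μ] {P : α × β → Prop}
    (h : ∀ b, ∀ᵐ a ∂μ, P (a, b)) : ∀ᵐ q ∂μ.prod Measure.count, P q := by
  -- Intersecting countably many conull sets in the first factor avoids any measurability of `P`.
  have h1 : ∀ᵐ q ∂μ.prod (Measure.count : Measure β), ∀ b, P (q.1, b) :=
    Measure.quasiMeasurePreserving_fst.ae (ae_all_iff.2 h)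
  exact h1.mono fun q hq => hq q.2

theorem corollary3p2 {n : ℕ} {Y : Type*} [MeasurableSpace Y] (ν : Measure Y) [SigmaFinite ν]
    [TopologicalSpace.SeparableSpace (Lp ℂ 2 ν)]
    (p : ℝ≥0∞) [Fact (1 ≤ p)] (hp : p ≠ ⊤)
    (σ : UnitAddTorus (Fin n) × (Fin n → ℤ) → (Lp ℂ 2 ν →L[ℂ] Lp ℂ 2 ν))
    (T : Lp (Lp ℂ 2 ν) p (volume : Measure (UnitAddTorus (Fin n))) →ₗ[ℂ]
      Lp (Lp ℂ 2 ν) p (volume : Measure (UnitAddTorus (Fin n))))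
    (hσ : IsPeriodicPseudoDiffOp σ T) (hT : IsNuclear T) :
    ∀ᵐ q : UnitAddTorus (Fin n) × (Fin n → ℤ)
        ∂((volume : Measure (UnitAddTorus (Fin n))).prod Measure.count),
      IsNuclear (σ q : Lp ℂ 2 ν →ₗ[ℂ] Lp ℂ 2 ν) ∧ IsTraceClassOp (σ q) := by
  refine ae_prod_count_of_forall_ae fun ξ => ?_
  filter_upwards [hσ.ae_isNuclear hT ξ] with x hx
  exact ⟨hx, hx.isTraceClassOp⟩
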